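/- Corollary 5.2 (cor:sym). Let $n\ge 1$. A convex body is a compact convex set with non-empty interior. For a convex body $K\subset\mathbb R^k$ and $z\in\mathrm{int}(K)$ put $K^z=\{y\in\mathbb R^k:\langle y-z,x-z\rangle\le 1\text{ for all }x\in K\}$, and let $\mathcal P(K)=\inf\{|K|\,|K^z| : z\in\mathrm{int}(K)\}$ be the volume product of $K$. The Santaló point of $K$ is the unique point $s(K)\in\mathrm{int}(K)$ with $|K^{s(K)}|=\min_{z\in\mathrm{int}(K)}|K^z|$. Let $\mathrm{Fix}(K)$ be the set of points $x\in\mathbb R^k$ with $Tx=x$ for every linear isometry $T$ of $\mathbb R^k$ with $TK=K$. Let $L\subset\mathbb R^{n-1}$ be a convex body such that $\mathrm{Fix}(L)$ is a single point, and identify $\mathbb R^{n-1}$ with the hyperplane $\{x_n=0\}$ of $\mathbb R^n$. Call $K=\mathrm{conv}(L,x,y)$ (closed convex hull) a double pyramid with base $L$ separating the apexes $x,y\in\mathbb R^n$ if $x$ and $y$ lie strictly on different sides of this hyperplane and the segment $[x,y]$ meets $L$. Then $L$ has a unique Santaló point $s(L)$, and for all $x_0,y_0\in\mathbb R^n\setminus\mathbb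 R^{n-1}$ which are symmetric with respect to $s(L)$, i.e. $\tfrac12(x_0+y_0)=s(L)$, the set $\mathrm{conv}(L,x_0,y_0)$ is such a double pyramid and $$\mathcal P(\mathrm{conv}(L,x,y))\le\mathcal P(\mathrm{conv}(L,x_0,y_0))$$ for every double pyramid $\mathrm{conv}(L,x,y)$ with base $L$ separating the apexes $x$ and $y$. -/

import Mathlib

noncomputable section

/-- A convex body of `ℝᵏ`: a compact convex subset with non-empty interior. -/
structure IsConvexBody {k : ℕ} (K : Set (EuclideanSpace ℝ (Fin k))) : Prop where
  isCompact : IsCompact K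
  convex : Convex ℝ K
  interior_nonempty : (interior K).Nonempty

/-- The polar body `K^z` of `K` with center of polarity `z`. -/
def polarAt {k : ℕ} (K : Set (EuclideanSpace ℝ (Fin k))) (z : EuclideanSpace ℝ (Fin k)) :
    Set (EuclideanSpace ℝ (Fin k)) :=
  {y | ∀ x ∈ K, inner ℝ (y - z) (x - z) ≤ 1}

/-- The volume product `𝒫(K) = inf {|K| |K^z| : z ∈ int K}`, with values in `[0, ∞]`
(it is finite on convex bodies). -/
def volumeProduct {k : ℕ} (K : Set (EuclideanSpace ℝ (Fin k))) : ENNReal :=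
  ⨅ z ∈ interior K, MeasureTheory.volume K * MeasureTheory.volume (polarAt K z)

/-- `s` is a Santaló point of `K`: an interior point of `K` at which `z ↦ |K^z|` attains its
minimum over the interior of `K`. -/
def IsSantaloPoint {k : ℕ} (K : Set (EuclideanSpace ℝ (Fin k)))
    (s : EuclideanSpace ℝ (Fin k)) : Prop :=
  s ∈ interior K ∧
    ∀ z ∈ interior K, MeasureTheory.volume (polarAt K s) ≤ MeasureTheory.volume (polarAt K z)

/-- `Fix(K)`: the points fixed by every linear isometry `T` of `ℝᵏ` with `T K = K`. -/
def fixSet {k : ℕ} (K : Set (EuclideanSpace ℝ (Fin k))) : Set (EuclideanSpace ℝ (Fin k)) :=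
  {x | ∀ T : EuclideanSpace ℝ (Fin k) ≃ₗᵢ[ℝ] EuclideanSpace ℝ (Fin k), T '' K = K → T x = x}

/-- The standard embedding `ℝᵈ → ℝᵈ⁺¹`, `v ↦ (v, 0)`. -/
def embedHyperplane {d : ℕ} (v : EuclideanSpace ℝ (Fin d)) : EuclideanSpace ℝ (Fin (d + 1)) :=
  WithLp.toLp 2 (Fin.snoc (α := fun _ => ℝ) (fun i => v i) 0)

/-- `conv(L, x, y)`, the closed convex hull of `L ⊆ ℝᵈ ⊆ ℝᵈ⁺¹` and the points `x`, `y`. -/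
def doublePyramid {d : ℕ} (L : Set (EuclideanSpace ℝ (Fin d)))
    (x y : EuclideanSpace ℝ (Fin (d + 1))) : Set (EuclideanSpace ℝ (Fin (d + 1))) :=
  closedConvexHull ℝ (embedHyperplane '' L ∪ {x, y})

/-- `L ⊆ ℝᵈ` separates the apexes `x, y ∈ ℝᵈ⁺¹`: they lie strictly on different sides of the
hyperplane `ℝᵈ`, and the segment joining them crosses this hyperplane in a point of `L`. -/
def SeparatesApexes {d : ℕ} (L : Set (EuclideanSpace ℝ (Fin d)))
    (x y : EuclideanSpace ℝ (Fin (d + 1))) : Prop :=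
  x (Fin.last d) * y (Fin.last d) < 0 ∧ (segment ℝ x y ∩ embedHyperplane '' L).Nonempty

end

/-! Symmetry puts everything at the origin. The centroids of `L` and of its polar body at `0` are
fixed by all symmetries of `L`, hence both are `0`. Therefore `0` is interior to `L`. The projective
map `u ↦ z + u / (1 - ⟨u, z⟩)` gives `|K^z| = ∫ (1 - ⟨u, z⟩)^(-(k+1)) du` over `K^0`, and convexity
of the integrand makes `z = 0` the minimizer as soon as `K^0` has centroid `0`. So `s(L) = 0`.

For a double pyramid write `y = (1+β)c - βx` with `c ∈ L`. Its volume is `|xₙ| (1+β) |L| / (d+1)`.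
In the coordinates `v = u'`, `s = ⟨u, x⟩` its polar body at `0` fibers over `L^0`, with fiber
`[((1+β)⟨v, c⟩ - 1)/β, 1]`. Up to exchanging the apexes, `β ≤ 1`. Testing the volume product at `z =
τx` weights the fibers by `(1 - τs)^(-(d+2))`; the weighted fiber length is concave in `p = ⟨v, c⟩`,
so it lies below an affine function `κ + lp`, whose integral over `L^0` is `κ |L^0|`. A suitable `τ`
gives `(1+β)κ ≤ 4` (`balanced_bound`, `exists_fiber_bound`), so `𝒫 ≤ 4 |L| |L^0| / (d+1)`.

For symmetric apexes `c = 0` and `β = 1`; the polar body is a linear image of `L^0 × [-1, 1]`, has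
centroid `0`, and the bound is attained at `z = 0`. -/

open MeasureTheory Set
open scoped RealInnerProductSpace ENNReal

/-! ### Polar bodies and the change of the center of polarity -/

section Polar

variable {k : ℕ}

lemma mem_polarAt_zero {K : Set (EuclideanSpace ℝ (Fin k))} {u : EuclideanSpace ℝ (Fin k)} :
    u ∈ polarAt K 0 ↔ ∀ x ∈ K, inner ℝ u x ≤ 1 := by
  simp [polarAt]

lemma isClosed_polarAt (K : Set (EuclideanSpace ℝ (Fin k))) (z : EuclideanSpace ℝ (Fin k)) :
    IsClosed (polarAt K z) := by
  have : polarAt K z = ⋂ x ∈ K, {y | inner ℝ (y - z) (x - z) ≤ 1} := by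
    ext y; simp [polarAt]
  rw [this]
  exact isClosed_biInter fun x _ => isClosed_le (by fun_prop) continuous_const

/-- Pushing `x` slightly in the direction `y - z` stays in `K` and strictly increases the inner
product. This keeps the denominators `1 - ⟨u, z⟩` positive. -/
lemma inner_lt_one_of_mem_interior {K : Set (EuclideanSpace ℝ (Fin k))}
    {x y z : EuclideanSpace ℝ (Fin k)} (hx : x ∈ interior K) (hy : y ∈ polarAt K z) :
    inner ℝ (y - z) (x - z) < 1 := by
  by_cases hyz : y - z = 0
  · simp [hyz]
  have hcont : Filter.Tendsto (fun t : ℝ => x + t • (y - z)) (nhds 0) (nhds x) := by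
    have : Continuous (fun t : ℝ => x + t • (y - z)) := by fun_prop
    simpa using this.tendsto 0
  have hev := hcont.eventually (mem_interior_iff_mem_nhds.mp hx)
  obtain ⟨ε, hε, hball⟩ := Metric.eventually_nhds_iff.mp hev
  have hmem : x + (ε / 2) • (y - z) ∈ K := by
    apply hball
    rw [Real.dist_eq, sub_zero, abs_of_pos (by positivity)]
    linarith
  have h1 := hy _ hmem
  have h2 : x + (ε / 2) • (y - z) - z = (x - z) + (ε / 2) • (y - z) := by abel
  rw [h2, inner_add_right, inner_smul_right, real_inner_self_eq_norm_sq] at h1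
  have : 0 < ‖y - z‖ := norm_pos_iff.mpr hyz
  have : 0 < ε / 2 * ‖y - z‖ ^ 2 := by positivity
  linarith

lemma polarAt_zero_bounded {K : Set (EuclideanSpace ℝ (Fin k))} (h0 : 0 ∈ interior K) :
    Bornology.IsBounded (polarAt K 0) := by
  obtain ⟨ε, hε, hball⟩ := Metric.mem_nhds_iff.mp (mem_interior_iff_mem_nhds.mp h0)
  refine (Metric.isBounded_iff_subset_closedBall 0).mpr ⟨2 / ε, fun u hu => ?_⟩
  rw [mem_closedBall_zero_iff]
  rcases eq_or_ne u 0 with rfl | hu0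
  · simp; positivity
  have hn : 0 < ‖u‖ := norm_pos_iff.mpr hu0
  have h1 := mem_polarAt_zero.mp hu ((ε / 2 * ‖u‖⁻¹) • u) (hball (by
    rw [mem_ball_zero_iff, norm_smul, Real.norm_of_nonneg (by positivity)]
    field_simp; linarith))
  rw [inner_smul_right, real_inner_self_eq_norm_sq] at h1
  rw [le_div_iff₀ hε]
  have : ε / 2 * ‖u‖⁻¹ * ‖u‖ ^ 2 = ε / 2 * ‖u‖ := by field_simp
  rw [this] at h1
  linarith

lemma isCompact_polarAt_zero {K : Set (EuclideanSpace ℝ (Fin k))} (h0 : 0 ∈ interior K) :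
    IsCompact (polarAt K 0) :=
  Metric.isCompact_of_isClosed_isBounded (isClosed_polarAt K 0) (polarAt_zero_bounded h0)

lemma zero_mem_interior_polarAt {K : Set (EuclideanSpace ℝ (Fin k))}
    (hK : Bornology.IsBounded K) : 0 ∈ interior (polarAt K 0) := by
  obtain ⟨R, hR, hKR⟩ := hK.subset_ball_lt 0 0
  refine mem_interior_iff_mem_nhds.mpr (Metric.mem_nhds_iff.mpr ⟨R⁻¹, by positivity, ?_⟩)
  intro u hu
  rw [mem_ball_zero_iff] at hu
  refine mem_polarAt_zero.mpr fun x hx => ?_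
  have hx' := hKR hx
  rw [mem_ball_zero_iff] at hx'
  calc inner ℝ u x ≤ ‖u‖ * ‖x‖ := real_inner_le_norm u x
    _ ≤ R⁻¹ * R := by gcongr
    _ = 1 := by field_simp

/-- The projective map carrying the polar body at the origin to the polar body at `z`. -/
noncomputable def polarShift (z u : EuclideanSpace ℝ (Fin k)) : EuclideanSpace ℝ (Fin k) :=
  z + (1 - inner ℝ u z)⁻¹ • u

/-- Clearing the positive denominator turns `⟨u, x - z⟩ / (1 - ⟨u, z⟩) ≤ 1` into `⟨u, x⟩ ≤ 1`. With
`w = y - z`, the inverse map is `w / (1 + ⟨w, z⟩)`. -/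
lemma polarShift_image {K : Set (EuclideanSpace ℝ (Fin k))} {z : EuclideanSpace ℝ (Fin k)}
    (h0 : 0 ∈ interior K) (hz : z ∈ interior K) :
    polarShift z '' polarAt K 0 = polarAt K z := by
  ext y
  constructor
  · rintro ⟨u, hu, rfl⟩ x hx
    have hs : 0 < 1 - inner ℝ u z := by
      have := inner_lt_one_of_mem_interior hz hu
      simp only [sub_zero] at this
      linarith
    have hux := mem_polarAt_zero.mp hu x hx
    rw [polarShift, add_sub_cancel_left, inner_smul_left, inner_sub_right]
    simp only [map_inv₀, conj_trivial]
    rw [inv_mul_le_iff₀ hs]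
    linarith
  · intro hy
    have hq : 0 < 1 + inner ℝ (y - z) z := by
      have := inner_lt_one_of_mem_interior h0 hy
      rw [zero_sub, inner_neg_right] at this
      linarith
    refine ⟨(1 + inner ℝ (y - z) z)⁻¹ • (y - z), mem_polarAt_zero.mpr fun x hx => ?_, ?_⟩
    · have := hy x hx
      rw [inner_sub_right] at this
      rw [inner_smul_left]
      simp only [map_inv₀, conj_trivial]
      rw [inv_mul_le_iff₀ hq]
      linarith
    · rw [polarShift, inner_smul_left]
      simp only [map_inv₀, conj_trivial, smul_smul]
      have : (1 - (1 + inner ℝ (y - z) z)⁻¹ * inner ℝ (y - z) z)⁻¹ *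
          (1 + inner ℝ (y - z) z)⁻¹ = 1 := by
        field_simp
        ring_nf
      rw [this, one_smul, add_sub_cancel]

lemma polarShift_injOn {K : Set (EuclideanSpace ℝ (Fin k))} {z : EuclideanSpace ℝ (Fin k)}
    (hz : z ∈ interior K) : InjOn (polarShift z) (polarAt K 0) := by
  intro u hu v hv huv
  have hs : 0 < 1 - inner ℝ u z := by
    have := inner_lt_one_of_mem_interior hz hu
    simp only [sub_zero] at this
    linarith
  have ht : 0 < 1 - inner ℝ v z := by
    have := inner_lt_one_of_mem_interior hz hv
    simp only [sub_zero] at this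
    linarith
  have h1 : (1 - inner ℝ u z)⁻¹ • u = (1 - inner ℝ v z)⁻¹ • v := by
    simpa [polarShift] using huv
  have h2 := congrArg (fun w => inner ℝ w z) h1
  simp only [inner_smul_left, map_inv₀, conj_trivial] at h2
  have h3 : inner ℝ u z = inner ℝ v z := by
    field_simp at h2
    linarith
  rw [h3] at h1
  exact smul_right_injective _ (inv_ne_zero ht.ne') h1

/-- The derivative of `polarShift z`. -/
noncomputable def polarShiftDeriv (z u : EuclideanSpace ℝ (Fin k)) :
    EuclideanSpace ℝ (Fin k) →L[ℝ] EuclideanSpace ℝ (Fin k) :=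
  (1 - inner ℝ u z)⁻¹ • (ContinuousLinearMap.id ℝ _ +
    (innerSL ℝ z).smulRight ((1 - inner ℝ u z)⁻¹ • u))

lemma polarShift_hasFDerivAt {z u : EuclideanSpace ℝ (Fin k)} (hs : 0 < 1 - inner ℝ u z) :
    HasFDerivAt (polarShift z) (polarShiftDeriv z u) u := by
  have h1 : HasFDerivAt (fun u => 1 - inner ℝ u z) (-(innerSL ℝ z)) u := by
    have := ((innerSL ℝ z).hasFDerivAt (x := u)).const_sub 1
    convert! this using 2 with v
    rw [innerSL_apply_apply, real_inner_comm]
  have h2 := (hasDerivAt_inv hs.ne').comp_hasFDerivAt u h1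
  have h3 := (h2.smul (hasFDerivAt_id u)).const_add z
  refine h3.congr_fderiv ?_
  ext1 v
  simp only [polarShiftDeriv, add_apply, smul_apply,
    ContinuousLinearMap.smulRight_apply, neg_apply, smul_eq_mul,
    ContinuousLinearMap.id_apply, Function.comp, id, smul_add, smul_smul]
  congr 2
  field_simp

/-- The scalar factor contributes `k` powers; the rank-one perturbation of the identity contributes
the last one, as `1 + ⟨u, z⟩ / (1 - ⟨u, z⟩) = (1 - ⟨u, z⟩)⁻¹`. -/
lemma polarShiftDeriv_det {z u : EuclideanSpace ℝ (Fin k)} (hs : 0 < 1 - inner ℝ u z) :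
    (polarShiftDeriv z u).det = ((1 - inner ℝ u z)⁻¹) ^ (k + 1) := by
  have : (polarShiftDeriv z u : EuclideanSpace ℝ (Fin k) →ₗ[ℝ] EuclideanSpace ℝ (Fin k)) =
      (1 - inner ℝ u z)⁻¹ • LinearMap.transvection (innerSL ℝ z).toLinearMap
        ((1 - inner ℝ u z)⁻¹ • u) := by
    ext1 v
    simp [polarShiftDeriv, LinearMap.transvection.apply]
  rw [ContinuousLinearMap.det, this, LinearMap.det_smul, LinearMap.transvection.det]
  simp only [finrank_euclideanSpace, Fintype.card_fin, pow_succ]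
  congr 1
  simp only [ContinuousLinearMap.coe_coe, innerSL_apply_apply, inner_smul_right]
  rw [real_inner_comm u z]
  have := hs.ne'
  field_simp
  ring

lemma volume_polarAt {K : Set (EuclideanSpace ℝ (Fin k))} {z : EuclideanSpace ℝ (Fin k)}
    (h0 : 0 ∈ interior K) (hz : z ∈ interior K) :
    volume (polarAt K z) =
      ∫⁻ u in polarAt K 0, ENNReal.ofReal (((1 - inner ℝ u z)⁻¹) ^ (k + 1)) := by
  have hs : ∀ u ∈ polarAt K 0, 0 < 1 - inner ℝ u z := fun u hu => by
    have := inner_lt_one_of_mem_interior hz hu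
    simp only [sub_zero] at this
    linarith
  have h := lintegral_image_eq_lintegral_abs_det_fderiv_mul volume
    (isClosed_polarAt K 0).measurableSet
    (fun u hu => (polarShift_hasFDerivAt (hs u hu)).hasFDerivWithinAt) (polarShift_injOn hz)
    (fun _ => 1)
  rw [polarShift_image h0 hz, setLIntegral_one] at h
  rw [h]
  refine setLIntegral_congr_fun (isClosed_polarAt K 0).measurableSet fun u hu => ?_
  simp only [mul_one]
  rw [polarShiftDeriv_det (hs u hu), abs_of_nonneg]
  have := hs u hu
  positivity

end Polar

/-! ### The Santaló point and the role of symmetry -/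

section Santalo

/-- No sign is required of `f`: the quadratic lower bound to be integrated is not known to be
nonnegative. -/
lemma ofReal_integral_le_lintegral {α : Type*} [MeasurableSpace α] {μ : Measure α} {f : α → ℝ}
    (hf : Integrable f μ) : ENNReal.ofReal (∫ a, f a ∂μ) ≤ ∫⁻ a, ENNReal.ofReal (f a) ∂μ := by
  refine ENNReal.ofReal_le_of_le_toReal ?_
  rw [integral_eq_lintegral_pos_part_sub_lintegral_neg_part hf]
  linarith [ENNReal.toReal_nonneg (a := ∫⁻ a, ENNReal.ofReal (-f a) ∂μ)]

/-- Bernoulli's inequality at `(1 - s)⁻¹ = 1 + s + s² / (1 - s)`. The quadratic term serves only to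
get strict minimality later. -/
lemma one_add_le_inv_one_sub_pow {s C : ℝ} (hs : 0 < 1 - s) (hC : 1 - s ≤ C) (m : ℕ) :
    1 + m * s + m * (s ^ 2 / C) ≤ ((1 - s)⁻¹) ^ m := by
  have h1 : 1 + (m : ℝ) * ((1 - s)⁻¹ - 1) ≤ (1 + ((1 - s)⁻¹ - 1)) ^ m :=
    one_add_mul_le_pow (by have := inv_pos.mpr hs; linarith) m
  have h2 : s + s ^ 2 / C ≤ (1 - s)⁻¹ - 1 := by
    have : s ^ 2 / C ≤ s ^ 2 / (1 - s) := by gcongr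
    have h3 : (1 - s)⁻¹ - 1 = s + s ^ 2 / (1 - s) := by field_simp; ring
    linarith
  rw [add_sub_cancel] at h1
  have : (m : ℝ) * (s + s ^ 2 / C) ≤ m * ((1 - s)⁻¹ - 1) := by gcongr
  linarith

variable {k : ℕ}

lemma volume_polarAt_zero_lt_top {K : Set (EuclideanSpace ℝ (Fin k))} (h0 : 0 ∈ interior K) :
    volume (polarAt K 0) < ∞ := (isCompact_polarAt_zero h0).measure_lt_top

/-- Integrating the previous bound over `K^0` kills the linear term; `C` bounds `1 - ⟨u, z⟩` on the
compact set `K^0`. -/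
lemma volume_polarAt_ge_add {K : Set (EuclideanSpace ℝ (Fin k))} {z : EuclideanSpace ℝ (Fin k)}
    (h0 : 0 ∈ interior K) (hz : z ∈ interior K)
    (hc : ∫ u in polarAt K 0, inner ℝ u z = 0) :
    ∃ c : ℝ, 0 < c ∧ ENNReal.ofReal (volume.real (polarAt K 0) +
      c * ∫ u in polarAt K 0, (inner ℝ u z) ^ 2) ≤ volume (polarAt K z) := by
  have hs : ∀ u ∈ polarAt K 0, 0 < 1 - inner ℝ u z := fun u hu => by
    have := inner_lt_one_of_mem_interior hz hu
    simp only [sub_zero] at this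
    linarith
  have hcpt := isCompact_polarAt_zero h0
  obtain ⟨C, hC⟩ := hcpt.exists_bound_of_continuousOn
    (f := fun u : EuclideanSpace ℝ (Fin k) => 1 - inner ℝ u z) (by fun_prop)
  have h0mem : (0 : EuclideanSpace ℝ (Fin k)) ∈ polarAt K 0 := mem_polarAt_zero.mpr (by simp)
  have hC1 : 1 ≤ C := by simpa using hC 0 h0mem
  have hi1 : IntegrableOn (fun u : EuclideanSpace ℝ (Fin k) => inner ℝ u z) (polarAt K 0) :=
    ContinuousOn.integrableOn_compact hcpt (by fun_prop)
  have hi2 : IntegrableOn (fun u : EuclideanSpace ℝ (Fin k) => (inner ℝ u z) ^ 2)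
      (polarAt K 0) := ContinuousOn.integrableOn_compact hcpt (by fun_prop)
  have hi0 : IntegrableOn (fun _ : EuclideanSpace ℝ (Fin k) => (1 : ℝ)) (polarAt K 0) :=
    ContinuousOn.integrableOn_compact hcpt (by fun_prop)
  refine ⟨((k + 1 : ℕ) : ℝ) / C, by positivity, ?_⟩
  have heq : volume.real (polarAt K 0) + ((k + 1 : ℕ) : ℝ) / C *
      ∫ u in polarAt K 0, (inner ℝ u z) ^ 2 =
      ∫ u in polarAt K 0, (1 + ((k + 1 : ℕ) : ℝ) * inner ℝ u z +
        ((k + 1 : ℕ) : ℝ) / C * (inner ℝ u z) ^ 2) := by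
    have hi01 : IntegrableOn (fun u : EuclideanSpace ℝ (Fin k) =>
        1 + ((k + 1 : ℕ) : ℝ) * inner ℝ u z) (polarAt K 0) := hi0.add (hi1.const_mul _)
    rw [integral_add hi01 (hi2.const_mul _),
      integral_add hi0 (hi1.const_mul _), integral_const_mul, integral_const_mul, hc]
    simp
  rw [heq, volume_polarAt h0 hz]
  refine (ofReal_integral_le_lintegral ((hi0.add (hi1.const_mul _)).add
    (hi2.const_mul _))).trans ?_
  refine setLIntegral_mono' (isClosed_polarAt K 0).measurableSet fun u hu => ?_
  refine ENNReal.ofReal_le_ofReal ?_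
  refine le_trans (le_of_eq ?_) (one_add_le_inv_one_sub_pow (hs u hu)
    ((le_abs_self _).trans (hC u hu)) (k + 1))
  simp only [Pi.add_apply]
  ring

lemma volume_polarAt_zero_le {K : Set (EuclideanSpace ℝ (Fin k))} {z : EuclideanSpace ℝ (Fin k)}
    (h0 : 0 ∈ interior K) (hz : z ∈ interior K)
    (hc : ∫ u in polarAt K 0, inner ℝ u z = 0) :
    volume (polarAt K 0) ≤ volume (polarAt K z) := by
  obtain ⟨c, hc0, h⟩ := volume_polarAt_ge_add h0 hz hc
  refine le_trans ?_ h
  rw [← ofReal_measureReal (volume_polarAt_zero_lt_top h0).ne]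
  refine ENNReal.ofReal_le_ofReal (le_add_of_nonneg_right ?_)
  exact mul_nonneg hc0.le (integral_nonneg fun u => sq_nonneg _)

/-- For `z ≠ 0` the second moment of `⟨u, z⟩` is positive, since `K^0` contains a ball around `0`.
This yields uniqueness of the Santaló point. -/
lemma volume_polarAt_zero_lt {K : Set (EuclideanSpace ℝ (Fin k))} {z : EuclideanSpace ℝ (Fin k)}
    (hK : Bornology.IsBounded K) (h0 : 0 ∈ interior K) (hz : z ∈ interior K) (hz0 : z ≠ 0)
    (hc : ∫ u in polarAt K 0, inner ℝ u z = 0) :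
    volume (polarAt K 0) < volume (polarAt K z) := by
  obtain ⟨c, hc0, h⟩ := volume_polarAt_ge_add h0 hz hc
  refine lt_of_lt_of_le ?_ h
  rw [← ofReal_measureReal (volume_polarAt_zero_lt_top h0).ne]
  suffices hpos : 0 < ∫ u in polarAt K 0, (inner ℝ u z) ^ 2 by
    have : 0 < c * ∫ u in polarAt K 0, (inner ℝ u z) ^ 2 := mul_pos hc0 hpos
    have h1 : 0 ≤ volume.real (polarAt K 0) := measureReal_nonneg
    exact (ENNReal.ofReal_lt_ofReal_iff (by linarith)).mpr (by linarith)
  rw [setIntegral_pos_iff_support_of_nonneg_ae (Filter.Eventually.of_forall fun u => sq_nonneg _)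
    (ContinuousOn.integrableOn_compact (isCompact_polarAt_zero h0) (by fun_prop))]
  have hopen : IsOpen ({u : EuclideanSpace ℝ (Fin k) | inner ℝ u z ≠ 0} ∩
      interior (polarAt K 0)) :=
    (isOpen_ne_fun (by fun_prop) continuous_const).inter isOpen_interior
  have hne : ({u : EuclideanSpace ℝ (Fin k) | inner ℝ u z ≠ 0} ∩
      interior (polarAt K 0)).Nonempty := by
    obtain ⟨ε, hε, hb⟩ := Metric.mem_nhds_iff.mp
      (isOpen_interior.mem_nhds (zero_mem_interior_polarAt hK))
    have hn : 0 < ‖z‖ := norm_pos_iff.mpr hz0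
    refine ⟨(ε / 2 * ‖z‖⁻¹) • z, ?_, hb ?_⟩
    · simp only [mem_ofPred_eq, inner_smul_left, real_inner_self_eq_norm_sq, conj_trivial]
      positivity
    · rw [mem_ball_zero_iff, norm_smul, Real.norm_of_nonneg (by positivity)]
      field_simp; linarith
  refine (hopen.measure_pos volume hne).trans_le (measure_mono ?_)
  rintro u ⟨hu1, hu2⟩
  exact ⟨by simpa using hu1, interior_subset hu2⟩

lemma map_setIntegral_id {S : Set (EuclideanSpace ℝ (Fin k))}
    (T : EuclideanSpace ℝ (Fin k) ≃ₗᵢ[ℝ] EuclideanSpace ℝ (Fin k)) (hT : T '' S = S) :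
    T (∫ u in S, u) = ∫ u in S, u := by
  have h1 : T (∫ u in S, u) = ∫ u in S, T u :=
    (T.toContinuousLinearEquiv.integral_comp_comm _).symm
  have h2 := T.measurePreserving.setIntegral_image_emb
    T.toHomeomorph.measurableEmbedding (fun u => u) S
  rw [h1, ← h2, hT]

lemma image_polarAt_zero {K : Set (EuclideanSpace ℝ (Fin k))}
    (T : EuclideanSpace ℝ (Fin k) ≃ₗᵢ[ℝ] EuclideanSpace ℝ (Fin k)) (hT : T '' K = K) :
    T '' polarAt K 0 = polarAt K 0 := by
  ext y
  constructor
  · rintro ⟨u, hu, rfl⟩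
    refine mem_polarAt_zero.mpr fun x hx => ?_
    rw [← hT] at hx
    obtain ⟨x', hx', rfl⟩ := hx
    rw [T.inner_map_map]
    exact mem_polarAt_zero.mp hu x' hx'
  · intro hy
    refine ⟨T.symm y, mem_polarAt_zero.mpr fun x hx => ?_, T.apply_symm_apply y⟩
    rw [← T.inner_map_map, T.apply_symm_apply]
    exact mem_polarAt_zero.mp hy _ (hT ▸ mem_image_of_mem T hx)

lemma eq_zero_of_mem_fixSet {L : Set (EuclideanSpace ℝ (Fin k))} (hFix : ∃ p, fixSet L = {p})
    {x : EuclideanSpace ℝ (Fin k)} (hx : x ∈ fixSet L) : x = 0 := by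
  obtain ⟨p, hp⟩ := hFix
  have h0 : (0 : EuclideanSpace ℝ (Fin k)) ∈ fixSet L := fun T _ => map_zero T
  rw [hp, mem_singleton_iff] at hx h0
  rw [hx, h0]

/-- The centroid of `L` is `0`. If `0` were not interior, a functional negative on `interior L`
would have negative integral over `L`, although it must vanish at the centroid. -/
lemma zero_mem_interior_of_fixSet {L : Set (EuclideanSpace ℝ (Fin k))} (hL : IsConvexBody L)
    (hFix : ∃ p, fixSet L = {p}) : 0 ∈ interior L := by
  have hcent : ∫ u in L, u = 0 :=
    eq_zero_of_mem_fixSet hFix fun T hT => map_setIntegral_id T hT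
  by_contra h0
  obtain ⟨f, hf⟩ := geometric_hahn_banach_open_point hL.convex.interior isOpen_interior h0
  rw [map_zero] at hf
  have hi : IntegrableOn (fun u : EuclideanSpace ℝ (Fin k) => u) L :=
    ContinuousOn.integrableOn_compact hL.isCompact (by fun_prop)
  have hz : ∫ u in L, f u = 0 := by
    rw [f.integral_comp_comm hi, hcent, map_zero]
  have hcl : L ⊆ closure (interior L) :=
    hL.convex.closure_interior_eq_closure_of_nonempty_interior hL.interior_nonempty ▸ subset_closure
  have hle : ∀ u ∈ L, f u ≤ 0 := fun u hu =>
    closure_minimal (fun v hv => (hf v hv).le) (isClosed_le f.continuous continuous_const) (hcl hu)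
  have hpos : 0 < ∫ u in L, -f u := by
    rw [setIntegral_pos_iff_support_of_nonneg_ae]
    · refine (isOpen_interior.measure_pos volume hL.interior_nonempty).trans_le
        (measure_mono fun u hu => ⟨?_, interior_subset hu⟩)
      simpa using (hf u hu).ne
    · exact (ae_restrict_iff' hL.isCompact.measurableSet).mpr
        (Filter.Eventually.of_forall fun u hu => by simpa using hle u hu)
    · exact (f.integrable_comp hi).neg
  rw [integral_neg, hz] at hpos
  simp at hpos

lemma setIntegral_polarAt_inner_of_fixSet {L : Set (EuclideanSpace ℝ (Fin k))}
    (hL : IsConvexBody L) (hFix : ∃ p, fixSet L = {p}) (z : EuclideanSpace ℝ (Fin k)) :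
    ∫ u in polarAt L 0, inner ℝ u z = 0 := by
  have hcent : ∫ u in polarAt L 0, u = 0 :=
    eq_zero_of_mem_fixSet hFix fun T hT => map_setIntegral_id T (image_polarAt_zero T hT)
  have hi : IntegrableOn (fun u : EuclideanSpace ℝ (Fin k) => u) (polarAt L 0) :=
    ContinuousOn.integrableOn_compact
      (isCompact_polarAt_zero (zero_mem_interior_of_fixSet hL hFix)) (by fun_prop)
  have := integral_inner (𝕜 := ℝ) hi z
  rw [hcent, inner_zero_right] at this
  rw [← this]
  exact integral_congr_ae (Filter.Eventually.of_forall fun u => real_inner_comm _ _)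

lemma isSantaloPoint_iff_eq_zero {L : Set (EuclideanSpace ℝ (Fin k))} (hL : IsConvexBody L)
    (hFix : ∃ p, fixSet L = {p}) (s : EuclideanSpace ℝ (Fin k)) :
    IsSantaloPoint L s ↔ s = 0 := by
  have h0 := zero_mem_interior_of_fixSet hL hFix
  constructor
  · rintro ⟨hs, hmin⟩
    by_contra hs0
    exact absurd (hmin 0 h0) (not_le.mpr (volume_polarAt_zero_lt hL.isCompact.isBounded h0 hs hs0
      (setIntegral_polarAt_inner_of_fixSet hL hFix s)))
  · rintro rfl
    exact ⟨h0, fun z hz => volume_polarAt_zero_le h0 hz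
      (setIntegral_polarAt_inner_of_fixSet hL hFix z)⟩

end Santalo

/-! ### Coordinates of `ℝᵈ⁺¹` and slicing of Lebesgue measure -/

section Slicing

lemma setLIntegral_Icc_ofReal_of_hasDerivAt {a b : ℝ} (hab : a ≤ b) {G g : ℝ → ℝ}
    (hG : ∀ x ∈ Icc a b, HasDerivAt G (g x) x) (hg : ContinuousOn g (Icc a b))
    (h0 : ∀ x ∈ Icc a b, 0 ≤ g x) :
    ∫⁻ x in Icc a b, ENNReal.ofReal (g x) = ENNReal.ofReal (G b - G a) := by
  rw [← ofReal_integral_eq_lintegral_ofReal (hg.integrableOn_compact isCompact_Icc)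
    ((ae_restrict_iff' measurableSet_Icc).mpr (Filter.Eventually.of_forall h0)),
    integral_Icc_eq_integral_Ioc, ← intervalIntegral.integral_of_le hab,
    intervalIntegral.integral_eq_sub_of_hasDerivAt]
  · rwa [uIcc_of_le hab]
  · exact (uIcc_of_le hab ▸ hg).intervalIntegrable

lemma lintegral_comp_add_mul {g : ℝ → ℝ≥0∞} (hg : Measurable g) {a : ℝ} (ha : a ≠ 0) (b : ℝ) :
    ∫⁻ t, g (b + t * a) = ENNReal.ofReal |a⁻¹| * ∫⁻ s, g s := by
  have h1 : ∫⁻ t, g (b + t * a) = ∫⁻ s, g (b + s) ∂(Measure.map (· * a) volume) :=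
    (lintegral_map (hg.comp (measurable_const_add b)) (measurable_mul_const a)).symm
  rw [h1, Real.map_volume_mul_right ha, lintegral_smul_measure, lintegral_add_left_eq_self,
    smul_eq_mul]

variable {d : ℕ}

/-- The point `(v, t)` of `ℝᵈ⁺¹`. -/
noncomputable def snocPoint (v : EuclideanSpace ℝ (Fin d)) (t : ℝ) :
    EuclideanSpace ℝ (Fin (d + 1)) :=
  WithLp.toLp 2 (Fin.snoc (α := fun _ => ℝ) (fun i => v i) t)

/-- The first `d` coordinates of a point of `ℝᵈ⁺¹`. -/
noncomputable def initPoint (u : EuclideanSpace ℝ (Fin (d + 1))) : EuclideanSpace ℝ (Fin d) :=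
  WithLp.toLp 2 fun i => u i.castSucc

@[simp] lemma snocPoint_last (v : EuclideanSpace ℝ (Fin d)) (t : ℝ) :
    snocPoint v t (Fin.last d) = t := by simp [snocPoint]

@[simp] lemma snocPoint_castSucc (v : EuclideanSpace ℝ (Fin d)) (t : ℝ) (i : Fin d) :
    snocPoint v t i.castSucc = v i := by simp [snocPoint]

@[simp] lemma initPoint_apply (u : EuclideanSpace ℝ (Fin (d + 1))) (i : Fin d) :
    initPoint u i = u i.castSucc := rfl

@[simp] lemma initPoint_snocPoint (v : EuclideanSpace ℝ (Fin d)) (t : ℝ) :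
    initPoint (snocPoint v t) = v := by ext i; simp

lemma snocPoint_initPoint (u : EuclideanSpace ℝ (Fin (d + 1))) :
    snocPoint (initPoint u) (u (Fin.last d)) = u := by
  ext i; refine Fin.lastCases ?_ (fun j => ?_) i <;> simp

lemma snocPoint_inj {v w : EuclideanSpace ℝ (Fin d)} {s t : ℝ} :
    snocPoint v s = snocPoint w t ↔ v = w ∧ s = t := by
  constructor
  · intro h
    exact ⟨by simpa using congrArg initPoint h, by simpa using congrArg (· (Fin.last d)) h⟩
  · rintro ⟨rfl, rfl⟩; rfl

lemma embedHyperplane_eq (v : EuclideanSpace ℝ (Fin d)) : embedHyperplane v = snocPoint v 0 := rfl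

lemma snocPoint_add (v w : EuclideanSpace ℝ (Fin d)) (s t : ℝ) :
    snocPoint v s + snocPoint w t = snocPoint (v + w) (s + t) := by
  ext i; refine Fin.lastCases ?_ (fun j => ?_) i <;> simp

lemma snocPoint_sub (v w : EuclideanSpace ℝ (Fin d)) (s t : ℝ) :
    snocPoint v s - snocPoint w t = snocPoint (v - w) (s - t) := by
  ext i; refine Fin.lastCases ?_ (fun j => ?_) i <;> simp

lemma smul_snocPoint (r : ℝ) (v : EuclideanSpace ℝ (Fin d)) (t : ℝ) :
    r • snocPoint v t = snocPoint (r • v) (r * t) := by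
  ext i; refine Fin.lastCases ?_ (fun j => ?_) i <;> simp

lemma inner_snocPoint (v w : EuclideanSpace ℝ (Fin d)) (s t : ℝ) :
    inner ℝ (snocPoint v s) (snocPoint w t) = inner ℝ v w + s * t := by
  simp [PiLp.inner_apply, Fin.sum_univ_castSucc, mul_comm]

lemma inner_embedHyperplane (u : EuclideanSpace ℝ (Fin (d + 1))) (w : EuclideanSpace ℝ (Fin d)) :
    inner ℝ u (embedHyperplane w) = inner ℝ (initPoint u) w := by
  rw [← snocPoint_initPoint u, embedHyperplane_eq, inner_snocPoint]; simp

lemma continuous_initPoint : Continuous (initPoint (d := d)) := by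
  unfold initPoint
  exact (PiLp.continuous_toLp 2 _).comp (continuous_pi fun i => by fun_prop)

lemma continuous_embedHyperplane : Continuous (embedHyperplane (d := d)) := by
  unfold embedHyperplane
  refine (PiLp.continuous_toLp 2 _).comp (continuous_pi fun i => ?_)
  refine Fin.lastCases ?_ (fun j => ?_) i
  · simpa using continuous_const
  · simp only [Fin.snoc_castSucc]; fun_prop

lemma measurePreserving_snocPoint :
    MeasurePreserving (fun q : EuclideanSpace ℝ (Fin d) × ℝ => snocPoint q.1 q.2)
      (volume.prod volume) volume := by
  have h1 : MeasurePreserving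
      (Prod.map (WithLp.ofLp : EuclideanSpace ℝ (Fin d) → (Fin d → ℝ)) (id : ℝ → ℝ))
      (volume.prod volume) (volume.prod volume) :=
    (PiLp.volume_preserving_ofLp (Fin d)).prod (MeasurePreserving.id volume)
  have h2 : MeasurePreserving (Prod.swap : (Fin d → ℝ) × ℝ → ℝ × (Fin d → ℝ))
      (volume.prod volume) (volume.prod volume) := Measure.measurePreserving_swap
  have h3 := (volume_preserving_piFinSuccAbove (fun _ : Fin (d + 1) => ℝ) (Fin.last d)).symm
  have h4 := (PiLp.volume_preserving_toLp (Fin (d + 1))).comp (h3.comp (h2.comp h1))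
  convert! h4 using 1
  ext q i
  refine Fin.lastCases ?_ (fun j => ?_) i
  · simp [MeasurableEquiv.piFinSuccAbove]
  · simp [MeasurableEquiv.piFinSuccAbove]

lemma measurable_snocPoint :
    Measurable (fun q : EuclideanSpace ℝ (Fin d) × ℝ => snocPoint q.1 q.2) :=
  measurePreserving_snocPoint.measurable

/-- The linear change of coordinates `u ↦ (u', ⟨u, x⟩)` scales Lebesgue measure by
`|xₙ|⁻¹`. -/
lemma map_initPoint_inner {x : EuclideanSpace ℝ (Fin (d + 1))} (hx : x (Fin.last d) ≠ 0) :
    Measure.map (fun u => (initPoint u, inner ℝ u x)) volume =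
      ENNReal.ofReal |(x (Fin.last d))⁻¹| •
        ((volume : Measure (EuclideanSpace ℝ (Fin d))).prod (volume : Measure ℝ)) := by
  have hmeas : Measurable fun u : EuclideanSpace ℝ (Fin (d + 1)) =>
      (initPoint u, (inner ℝ u x : ℝ)) :=
    (continuous_initPoint.prodMk (by fun_prop)).measurable
  refine Measure.ext_of_lintegral _ fun f hf => ?_
  have hf' : Measurable fun u : EuclideanSpace ℝ (Fin (d + 1)) =>
      f (initPoint u, (inner ℝ u x : ℝ)) := hf.comp hmeas
  have hf'' : Measurable fun q : EuclideanSpace ℝ (Fin d) × ℝ =>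
      f (initPoint (snocPoint q.1 q.2), (inner ℝ (snocPoint q.1 q.2) x : ℝ)) :=
    hf'.comp measurable_snocPoint
  rw [lintegral_map hf hmeas, lintegral_smul_measure, smul_eq_mul,
    ← measurePreserving_snocPoint.lintegral_comp hf',
    lintegral_prod _ hf''.aemeasurable,
    lintegral_prod _ hf.aemeasurable,
    ← lintegral_const_mul _ hf.lintegral_prod_right']
  refine lintegral_congr fun v => ?_
  have hfv : Measurable fun s : ℝ => f (v, s) := hf.comp measurable_prodMk_left
  rw [← lintegral_comp_add_mul hfv hx (inner ℝ v (initPoint x))]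
  refine lintegral_congr fun t => ?_
  simp only [initPoint_snocPoint]
  nth_rewrite 1 [← snocPoint_initPoint x]
  rw [inner_snocPoint]

lemma volume_eq_lintegral_slice {S : Set (EuclideanSpace ℝ (Fin (d + 1)))} (hS : MeasurableSet S)
    {a : ℝ} (ha : a ≠ 0) :
    volume S = ENNReal.ofReal |a| * ∫⁻ r : ℝ, volume {v | snocPoint v (r * a) ∈ S} := by
  have h1 := measurePreserving_snocPoint.measure_preimage hS.nullMeasurableSet
  rw [← h1, Measure.prod_apply_symm (measurable_snocPoint hS)]
  have h2 := lintegral_comp_add_mul (measurable_measure_prodMk_right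
    (μ := (volume : Measure (EuclideanSpace ℝ (Fin d)))) (measurable_snocPoint hS)) ha 0
  simp only [zero_add] at h2
  have h3 : ∫⁻ r : ℝ, volume {v | snocPoint v (r * a) ∈ S} = _ := h2
  rw [h3, ← mul_assoc, ← ENNReal.ofReal_mul (abs_nonneg _), ← abs_mul, mul_inv_cancel₀ ha]
  simp

end Slicing

/-! ### Geometry and volume of double pyramids -/

section Pyramid

variable {d : ℕ}

lemma isCompact_convexJoin_singleton {E : Type*} [NormedAddCommGroup E] [NormedSpace ℝ E]
    {C : Set E} (hC : IsCompact C) (x : E) : IsCompact (convexJoin ℝ {x} C) := by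
  have : convexJoin ℝ {x} C =
      (fun q : ℝ × E => (1 - q.1) • x + q.1 • q.2) '' (Icc (0 : ℝ) 1 ×ˢ C) := by
    ext u
    simp only [convexJoin_singleton_left, mem_iUnion, exists_prop, segment_eq_image, mem_image,
      mem_prod, Prod.exists]
    constructor
    · rintro ⟨c, hc, t, ht, rfl⟩; exact ⟨t, c, ⟨ht, hc⟩, rfl⟩
    · rintro ⟨t, c, ⟨ht, hc⟩, rfl⟩; exact ⟨c, hc, t, ht, rfl⟩
  rw [this]
  exact (isCompact_Icc.prod hC).image (by fun_prop)

lemma convex_embedHyperplane_image {L : Set (EuclideanSpace ℝ (Fin d))} (hL : Convex ℝ L) :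
    Convex ℝ (embedHyperplane '' L) := by
  rintro _ ⟨v, hv, rfl⟩ _ ⟨w, hw, rfl⟩ p q hp hq hpq
  refine ⟨p • v + q • w, hL hv hw hp hq hpq, ?_⟩
  simp [embedHyperplane_eq, smul_snocPoint, snocPoint_add]

lemma doublePyramid_eq_convexJoin {L : Set (EuclideanSpace ℝ (Fin d))} (hL : IsConvexBody L)
    (x y : EuclideanSpace ℝ (Fin (d + 1))) :
    doublePyramid L x y = convexJoin ℝ {x} (convexJoin ℝ {y} (embedHyperplane '' L)) := by
  have hne : (embedHyperplane '' L).Nonempty :=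
    (hL.interior_nonempty.mono interior_subset).image _
  have h : convexHull ℝ (embedHyperplane '' L ∪ {x, y}) =
      convexJoin ℝ {x} (convexJoin ℝ {y} (embedHyperplane '' L)) := by
    rw [union_comm, insert_union, singleton_union, convexHull_insert (insert_nonempty _ _),
      convexHull_insert hne, (convex_embedHyperplane_image hL.convex).convexHull_eq]
  rw [doublePyramid, closedConvexHull_eq_closure_convexHull, h]
  exact (isCompact_convexJoin_singleton (isCompact_convexJoin_singleton
    (hL.isCompact.image continuous_embedHyperplane) y) x).isClosed.closure_eq

lemma isCompact_doublePyramid {L : Set (EuclideanSpace ℝ (Fin d))} (hL : IsConvexBody L)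
    (x y : EuclideanSpace ℝ (Fin (d + 1))) : IsCompact (doublePyramid L x y) := by
  rw [doublePyramid_eq_convexJoin hL]
  exact isCompact_convexJoin_singleton (isCompact_convexJoin_singleton
    (hL.isCompact.image continuous_embedHyperplane) y) x

lemma convex_doublePyramid (L : Set (EuclideanSpace ℝ (Fin d)))
    (x y : EuclideanSpace ℝ (Fin (d + 1))) : Convex ℝ (doublePyramid L x y) :=
  convex_closedConvexHull

lemma subset_doublePyramid (L : Set (EuclideanSpace ℝ (Fin d)))
    (x y : EuclideanSpace ℝ (Fin (d + 1))) :
    embedHyperplane '' L ∪ {x, y} ⊆ doublePyramid L x y :=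
  subset_closedConvexHull

lemma doublePyramid_comm (L : Set (EuclideanSpace ℝ (Fin d)))
    (x y : EuclideanSpace ℝ (Fin (d + 1))) : doublePyramid L x y = doublePyramid L y x := by
  rw [doublePyramid, doublePyramid, pair_comm]

lemma exists_of_mem_doublePyramid {L : Set (EuclideanSpace ℝ (Fin d))} (hL : IsConvexBody L)
    {x y u : EuclideanSpace ℝ (Fin (d + 1))} (hu : u ∈ doublePyramid L x y) :
    ∃ l ∈ L, ∃ p q : ℝ, 0 ≤ p ∧ 0 ≤ q ∧ p + q ≤ 1 ∧
      u = (1 - p - q) • embedHyperplane l + p • x + q • y := by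
  rw [doublePyramid_eq_convexJoin hL] at hu
  simp only [mem_convexJoin, mem_singleton_iff, exists_eq_left] at hu
  obtain ⟨w, ⟨_, ⟨l, hl, rfl⟩, a, b, ha, hb, hab, rfl⟩, p, q, hp, hq, hpq, rfl⟩ := hu
  refine ⟨l, hl, p, q * a, hp, by positivity, ?_, ?_⟩
  · nlinarith
  · have : 1 - p - q * a = q * b := by
      have : b = 1 - a := by linarith
      rw [this]; linear_combination (-1) * hpq
    rw [this, smul_add, smul_smul, smul_smul]; abel

/-- The segment from `x` to `y` crosses the base in the interior point `c` of the segment. -/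
structure CrossesAt (L : Set (EuclideanSpace ℝ (Fin d))) (x y : EuclideanSpace ℝ (Fin (d + 1)))
    (c : EuclideanSpace ℝ (Fin d)) (β : ℝ) : Prop where
  last_ne : x (Fin.last d) ≠ 0
  mem : c ∈ L
  pos : 0 < β
  eq : y = (1 + β) • embedHyperplane c - β • x

lemma CrossesAt.symm {L : Set (EuclideanSpace ℝ (Fin d))} {x y : EuclideanSpace ℝ (Fin (d + 1))}
    {c : EuclideanSpace ℝ (Fin d)} {β : ℝ} (h : CrossesAt L x y c β) :
    CrossesAt L y x c β⁻¹ := by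
  have hβ := h.pos.ne'
  refine ⟨?_, h.mem, inv_pos.mpr h.pos, ?_⟩
  · rw [h.eq]
    simp [embedHyperplane_eq, hβ, h.last_ne]
  · rw [h.eq, smul_sub, smul_smul, smul_smul, inv_mul_cancel₀ hβ, one_smul, ← sub_add, ← sub_smul]
    have : 1 + β⁻¹ - β⁻¹ * (1 + β) = 0 := by field_simp; ring
    rw [this]; simp

lemma CrossesAt.last_eq {L : Set (EuclideanSpace ℝ (Fin d))}
    {x y : EuclideanSpace ℝ (Fin (d + 1))} {c : EuclideanSpace ℝ (Fin d)} {β : ℝ}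
    (h : CrossesAt L x y c β) : y (Fin.last d) = -(β * x (Fin.last d)) := by
  rw [h.eq]; simp [embedHyperplane_eq]

lemma SeparatesApexes.exists_crossesAt {L : Set (EuclideanSpace ℝ (Fin d))}
    {x y : EuclideanSpace ℝ (Fin (d + 1))} (h : SeparatesApexes L x y) :
    ∃ c β, CrossesAt L x y c β := by
  obtain ⟨hneg, w, ⟨p, q, hp, hq, hpq, hw⟩, c, hc, rfl⟩ := h
  have hx : x (Fin.last d) ≠ 0 := fun h => by simp [h] at hneg
  have hlast := congrArg (· (Fin.last d)) hw
  simp only [embedHyperplane_eq, snocPoint_last, PiLp.add_apply, PiLp.smul_apply,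
    smul_eq_mul] at hlast
  have hq0 : q ≠ 0 := by
    rintro rfl
    have : p = 1 := by linarith
    subst this
    simp at hlast; exact hx hlast
  have hp0 : p ≠ 0 := by
    rintro rfl
    have : q = 1 := by linarith
    subst this
    have : y (Fin.last d) = 0 := by simpa using hlast
    simp [this] at hneg
  have hq' : 0 < q := lt_of_le_of_ne hq (Ne.symm hq0)
  have hp' : 0 < p := lt_of_le_of_ne hp (Ne.symm hp0)
  refine ⟨c, p / q, hx, hc, by positivity, ?_⟩
  have h1 : 1 + p / q = q⁻¹ := by field_simp; linarith
  rw [h1, ← hw, smul_add, smul_smul, smul_smul, inv_mul_cancel₀ hq0, one_smul, div_eq_inv_mul]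
  abel

variable {L : Set (EuclideanSpace ℝ (Fin d))} {x y : EuclideanSpace ℝ (Fin (d + 1))}
  {c : EuclideanSpace ℝ (Fin d)} {β : ℝ}

/-- On the side of `x` the body is the cone over `L` with apex `x`: any weight on `y` can be traded
for weight on `c ∈ L` and negative weight on `x`. -/
lemma CrossesAt.mem_doublePyramid_iff (h : CrossesAt L x y c β) (hL : IsConvexBody L) {r : ℝ}
    (hr0 : 0 ≤ r) (hr1 : r ≤ 1) (v : EuclideanSpace ℝ (Fin d)) :
    snocPoint v (r * x (Fin.last d)) ∈ doublePyramid L x y ↔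
      v ∈ AffineMap.homothety (initPoint x) (1 - r) '' L := by
  have hx := h.last_ne
  have hβ := h.pos
  obtain ⟨x', a, rfl⟩ : ∃ x' a, x = snocPoint x' a := ⟨_, _, (snocPoint_initPoint x).symm⟩
  simp only [snocPoint_last, initPoint_snocPoint] at hx ⊢
  constructor
  · intro hv
    obtain ⟨l, hl, p, q, hp, hq, hpq, huv⟩ := exists_of_mem_doublePyramid hL hv
    rw [h.eq] at huv
    simp only [embedHyperplane_eq, smul_snocPoint, snocPoint_sub, snocPoint_add,
      snocPoint_inj] at huv
    obtain ⟨hv', hr⟩ := huv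
    have hr' : r = p - q * β := by
      apply mul_right_cancel₀ hx
      linear_combination hr
    -- Substituting for `y` gives `c` the weight `q(1+β)`; `l` and `c` merge into one point of `L`
    -- of total weight `1 - r`.
    obtain ⟨w, hw, hweq⟩ := hL.convex.exists_mem_add_smul_eq hl h.mem
      (show 0 ≤ 1 - p - q by linarith) (show 0 ≤ q * (1 + β) by positivity)
    refine ⟨w, hw, ?_⟩
    change AffineMap.homothety x' (1 - r) w = v
    rw [AffineMap.homothety_apply, vsub_eq_sub, vadd_eq_add, hv']
    have h1 : 1 - r = 1 - p - q + q * (1 + β) := by rw [hr']; ring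
    rw [smul_sub]
    nth_rewrite 1 [h1]
    rw [hweq, hr']
    module
  · rintro ⟨l, hl, rfl⟩
    have hl' : embedHyperplane l ∈ doublePyramid L (snocPoint x' a) y :=
      subset_doublePyramid _ _ _ (Or.inl ⟨l, hl, rfl⟩)
    have hx' : snocPoint x' a ∈ doublePyramid L (snocPoint x' a) y :=
      subset_doublePyramid _ _ _ (Or.inr (Or.inl rfl))
    have := convex_doublePyramid L (snocPoint x' a) y hl' hx' (show 0 ≤ 1 - r by linarith) hr0
      (by ring)
    convert! this using 1
    simp only [embedHyperplane_eq, smul_snocPoint, snocPoint_add, snocPoint_inj]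
    refine ⟨?_, by ring⟩
    rw [AffineMap.homothety_apply, vsub_eq_sub, vadd_eq_add]
    module

lemma CrossesAt.mem_doublePyramid_iff_neg (h : CrossesAt L x y c β) (hL : IsConvexBody L) {r : ℝ}
    (hr0 : r ≤ 0) (hr1 : -β ≤ r) (v : EuclideanSpace ℝ (Fin d)) :
    snocPoint v (r * x (Fin.last d)) ∈ doublePyramid L x y ↔
      v ∈ AffineMap.homothety (initPoint y) (1 + r / β) '' L := by
  have hβ := h.pos
  have h1 := h.symm.mem_doublePyramid_iff hL (r := -r / β)
    (div_nonneg (by linarith) hβ.le) (by rw [div_le_one hβ]; linarith) v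
  rw [doublePyramid_comm L y x] at h1
  have h2 : -r / β * y (Fin.last d) = r * x (Fin.last d) := by
    rw [h.last_eq]; field_simp
  rw [h2] at h1
  rw [h1, neg_div, sub_neg_eq_add]

lemma CrossesAt.bounds_of_mem (h : CrossesAt L x y c β) (hL : IsConvexBody L) {r : ℝ}
    {v : EuclideanSpace ℝ (Fin d)}
    (hv : snocPoint v (r * x (Fin.last d)) ∈ doublePyramid L x y) : -β ≤ r ∧ r ≤ 1 := by
  have hβ := h.pos
  obtain ⟨l, hl, p, q, hp, hq, hpq, huv⟩ := exists_of_mem_doublePyramid hL hv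
  have hr := congrArg (· (Fin.last d)) huv
  simp only [snocPoint_last, embedHyperplane_eq, PiLp.add_apply, PiLp.smul_apply, smul_eq_mul,
    h.last_eq] at hr
  have hr' : r = p - q * β := by
    apply mul_right_cancel₀ h.last_ne
    linear_combination hr
  constructor <;> nlinarith

/-- Near `0`, undoing the homothety of the slice through `u` gives a point near `0`, hence in `L`.
The side on which `u` lies decides which apex to use. -/
lemma CrossesAt.zero_mem_interior (h : CrossesAt L x y c β) (hL : IsConvexBody L)
    (h0 : 0 ∈ interior L) : 0 ∈ interior (doublePyramid L x y) := by
  have key : ∀ z : EuclideanSpace ℝ (Fin (d + 1)), z (Fin.last d) ≠ 0 →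
      ∀ᶠ u in nhds (0 : EuclideanSpace ℝ (Fin (d + 1))),
        (1 - u (Fin.last d) / z (Fin.last d))⁻¹ •
          (initPoint u - (u (Fin.last d) / z (Fin.last d)) • initPoint z) ∈ L ∧
        u (Fin.last d) / z (Fin.last d) < 1 := by
    intro z hz
    have hi : initPoint (0 : EuclideanSpace ℝ (Fin (d + 1))) = 0 := by ext i; simp
    have hc1 : ContinuousAt (fun u : EuclideanSpace ℝ (Fin (d + 1)) =>
        (1 - u (Fin.last d) / z (Fin.last d))⁻¹ •
          (initPoint u - (u (Fin.last d) / z (Fin.last d)) • initPoint z)) 0 := by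
      have := (continuous_initPoint (d := d)).continuousAt (x := 0)
      have hc0 : ContinuousAt (fun u : EuclideanSpace ℝ (Fin (d + 1)) =>
          (1 - u (Fin.last d) / z (Fin.last d))⁻¹) 0 :=
        ContinuousAt.inv₀ (by fun_prop) (by simp)
      refine hc0.smul ?_
      exact this.sub (by fun_prop)
    have hc2 : ContinuousAt (fun u : EuclideanSpace ℝ (Fin (d + 1)) =>
        u (Fin.last d) / z (Fin.last d)) 0 := by fun_prop
    refine (hc1.eventually ?_).and (hc2.tendsto.eventually_lt_const (by simp))
    simpa [hi] using mem_interior_iff_mem_nhds.mp h0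
  refine mem_interior_iff_mem_nhds.mpr ?_
  filter_upwards [key x h.last_ne, key y h.symm.last_ne] with u hux huy
  have hstep : ∀ z : EuclideanSpace ℝ (Fin (d + 1)), z (Fin.last d) ≠ 0 →
      u (Fin.last d) / z (Fin.last d) < 1 →
      u = snocPoint (initPoint u) (u (Fin.last d) / z (Fin.last d) * z (Fin.last d)) ∧
      AffineMap.homothety (initPoint z) (1 - u (Fin.last d) / z (Fin.last d))
        ((1 - u (Fin.last d) / z (Fin.last d))⁻¹ •
          (initPoint u - (u (Fin.last d) / z (Fin.last d)) • initPoint z)) = initPoint u := by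
    intro z hz hlt
    refine ⟨by rw [div_mul_cancel₀ _ hz, snocPoint_initPoint], ?_⟩
    have : 1 - u (Fin.last d) / z (Fin.last d) ≠ 0 := by linarith
    rw [AffineMap.homothety_apply, vsub_eq_sub, vadd_eq_add, smul_sub, smul_smul,
      mul_inv_cancel₀ this]
    module
  rcases le_total 0 (u (Fin.last d) / x (Fin.last d)) with hr | hr
  · obtain ⟨h1, h2⟩ := hstep x h.last_ne hux.2
    rw [h1, h.mem_doublePyramid_iff hL hr hux.2.le]
    exact ⟨_, hux.1, h2⟩
  · obtain ⟨h1, h2⟩ := hstep y h.symm.last_ne huy.2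
    rw [h1, doublePyramid_comm, h.symm.mem_doublePyramid_iff hL ?_ huy.2.le]
    · exact ⟨_, huy.1, h2⟩
    · rw [h.last_eq, div_neg, mul_comm, ← div_div, neg_nonneg]
      exact div_nonpos_of_nonpos_of_nonneg hr h.pos.le

lemma volume_homothety_image (v : EuclideanSpace ℝ (Fin d)) {r : ℝ} (hr : 0 ≤ r) :
    volume (AffineMap.homothety v r '' L) = ENNReal.ofReal (r ^ d) * volume L := by
  rw [Measure.addHaar_image_homothety]
  simp [abs_of_nonneg (pow_nonneg hr d)]

lemma CrossesAt.volume_doublePyramid (h : CrossesAt L x y c β) (hL : IsConvexBody L) :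
    volume (doublePyramid L x y) =
      ENNReal.ofReal (|x (Fin.last d)| * ((1 + β) / (d + 1))) * volume L := by
  have hβ := h.pos
  have hslice : ∀ r : ℝ, volume {v | snocPoint v (r * x (Fin.last d)) ∈ doublePyramid L x y} =
      -- Half-open on the side of `y`, so that the base slice `r = 0` is counted once.
      ((Icc (0 : ℝ) 1).indicator (fun r => ENNReal.ofReal ((1 - r) ^ d)) r +
        (Ico (-β) 0).indicator (fun r => ENNReal.ofReal ((1 + r / β) ^ d)) r) * volume L := by
    intro r
    by_cases h1 : r ∈ Icc (0 : ℝ) 1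
    · have h2 : r ∉ Ico (-β) 0 := fun h2 => absurd h1.1 (not_le.mpr h2.2)
      rw [indicator_of_mem h1, indicator_of_notMem h2, add_zero,
        ← volume_homothety_image (initPoint x) (by linarith [h1.2])]
      congr 1
      ext v
      exact h.mem_doublePyramid_iff hL h1.1 h1.2 v
    rw [indicator_of_notMem h1, zero_add]
    by_cases h2 : r ∈ Ico (-β) 0
    · have h3 : -1 ≤ r / β := by rw [le_div_iff₀ hβ]; linarith [h2.1]
      rw [indicator_of_mem h2, ← volume_homothety_image (initPoint y) (by linarith)]
      congr 1
      ext v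
      exact h.mem_doublePyramid_iff_neg hL h2.2.le h2.1 v
    · rw [indicator_of_notMem h2, zero_mul]
      convert! measure_empty (μ := (volume : Measure (EuclideanSpace ℝ (Fin d))))
      rw [Set.eq_empty_iff_forall_notMem]
      intro v hv
      obtain ⟨h3, h4⟩ := h.bounds_of_mem hL hv
      rcases le_or_gt 0 r with h5 | h5
      · exact h1 ⟨h5, h4⟩
      · exact h2 ⟨h3, h5⟩
  have hI1 : ∫⁻ r in Icc (0 : ℝ) 1, ENNReal.ofReal ((1 - r) ^ d) =
      ENNReal.ofReal (1 / (d + 1)) := by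
    rw [setLIntegral_Icc_ofReal_of_hasDerivAt zero_le_one
      (G := fun r => -((1 - r) ^ (d + 1) / (d + 1)))]
    · simp
    · intro r _
      have := ((((hasDerivAt_id r).const_sub 1).pow (d + 1)).div_const ((d : ℝ) + 1)).neg
      refine this.congr_deriv ?_
      push_cast
      simp only [id]
      have : (d : ℝ) + 1 ≠ 0 := by positivity
      field_simp
    · fun_prop
    · intro r hr; exact pow_nonneg (by linarith [hr.2]) _
  have hI2 : ∫⁻ r in Icc (-β) 0, ENNReal.ofReal ((1 + r / β) ^ d) =
      ENNReal.ofReal (β / (d + 1)) := by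
    rw [setLIntegral_Icc_ofReal_of_hasDerivAt (by linarith)
      (G := fun r => β * (1 + r / β) ^ (d + 1) / (d + 1))]
    · simp [hβ.ne']
    · intro r _
      have := (((((hasDerivAt_id r).div_const β).const_add 1).pow (d + 1)).const_mul β).div_const
        ((d : ℝ) + 1)
      refine this.congr_deriv ?_
      push_cast
      simp only [id]
      have : (d : ℝ) + 1 ≠ 0 := by positivity
      field_simp
    · fun_prop
    · intro r hr
      have : -1 ≤ r / β := by rw [le_div_iff₀ hβ]; linarith [hr.1]
      exact pow_nonneg (by linarith) _
  rw [volume_eq_lintegral_slice (isCompact_doublePyramid hL x y).measurableSet h.last_ne]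
  simp_rw [hslice]
  rw [lintegral_mul_const' _ _ hL.isCompact.measure_lt_top.ne, lintegral_add_left
    ((by fun_prop : Measurable fun r : ℝ => ENNReal.ofReal ((1 - r) ^ d)).indicator
      measurableSet_Icc), lintegral_indicator measurableSet_Icc, lintegral_indicator
      measurableSet_Ico, setLIntegral_congr Ico_ae_eq_Icc, hI1, hI2,
    ← ENNReal.ofReal_add (by positivity) (by positivity), ← mul_assoc,
    ← ENNReal.ofReal_mul (abs_nonneg _), ← add_div]

end Pyramid

/-! ### The one-dimensional inequality -/

section OneDim

/-- A power mean inequality: `t ↦ t^(i/m)` is concave, hence below its tangent at `1`; sum this at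
`t = P^m` and `t = Q^m`. -/
lemma pow_add_pow_le_two {P Q : ℝ} (hP : 0 ≤ P) (hQ : 0 ≤ Q) {m i : ℕ} (hi : i ≤ m) (hm : m ≠ 0)
    (h : P ^ m + Q ^ m = 2) : P ^ i + Q ^ i ≤ 2 := by
  have key : ∀ x : ℝ, 0 ≤ x → x ^ i ≤ 1 + (i / m : ℝ) * (x ^ m - 1) := by
    intro x hx
    have hm' : (0 : ℝ) < m := by positivity
    have h1 := rpow_one_add_le_one_add_mul_self (s := x ^ m - 1) (p := (i / m : ℝ))
      (by have := pow_nonneg hx m; linarith) (by positivity)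
      (by rw [div_le_one hm']; exact_mod_cast hi)
    rw [add_sub_cancel, ← Real.rpow_natCast x m, ← Real.rpow_mul hx,
      mul_div_cancel₀ _ hm'.ne', Real.rpow_natCast] at h1
    rw [← Real.rpow_natCast x m]
    exact h1
  have h1 := key P hP
  have h2 := key Q hQ
  have h3 : (i / m : ℝ) * (P ^ m - 1) + (i / m : ℝ) * (Q ^ m - 1) = 0 := by
    rw [← mul_add]
    have : P ^ m - 1 + (Q ^ m - 1) = 0 := by linarith
    rw [this, mul_zero]
  linarith

/-- The left side equals `2` at `τ = 0` with derivative `m(1 - 1/β) < 0`, and is at least `2^m ≥ 2`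
at `τ = 1/2`; apply the intermediate value theorem. -/
lemma exists_balanced {β : ℝ} (hβ : 0 < β) (hβ1 : β < 1) {m : ℕ} (hm : m ≠ 0) :
    ∃ τ : ℝ, 0 < τ ∧ τ < 1 ∧ ((1 - τ)⁻¹) ^ m + ((1 + τ / β)⁻¹) ^ m = 2 := by
  set f : ℝ → ℝ := fun τ => ((1 - τ)⁻¹) ^ m + ((1 + τ / β)⁻¹) ^ m with hf
  have hderiv : HasDerivAt f (m - m / β) 0 := by
    have h1 := (((hasDerivAt_id (0 : ℝ)).const_sub 1).inv (by simp)).pow m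
    have h2 := ((((hasDerivAt_id (0 : ℝ)).div_const β).const_add 1).inv (by simp)).pow m
    refine (h1.add h2).congr_deriv ?_
    simp
    ring
  have hneg : (m : ℝ) - m / β < 0 := by
    have hm' : (0 : ℝ) < m := by positivity
    have : (m : ℝ) < m / β := by rw [lt_div_iff₀ hβ]; nlinarith
    linarith
  have hslope := (hasDerivAt_iff_tendsto_slope.mp hderiv).eventually_lt_const hneg
  have hslope' := hslope.filter_mono (nhdsGT_le_nhdsNE 0)
  obtain ⟨τ₁, hτ₁, hmem⟩ := (hslope'.and (Ioo_mem_nhdsGT (show (0 : ℝ) < 1 / 2 by norm_num))).exists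
  have hf0 : f 0 = 2 := by simp [hf]; norm_num
  have hlt : f τ₁ < 2 := by
    rw [slope_def_field, hf0, sub_zero, div_lt_iff₀ hmem.1, zero_mul] at hτ₁
    linarith
  have hge : 2 ≤ f (1 / 2) := by
    have h1 : (2 : ℝ) ≤ 2 ^ m := le_self_pow₀ (by norm_num) hm
    have h2 : (0 : ℝ) ≤ ((1 + 1 / 2 / β)⁻¹) ^ m := by positivity
    have h3 : ((1 - 1 / 2 : ℝ)⁻¹) = 2 := by norm_num
    simp only [hf]
    rw [h3]
    linarith
  have hcont : ContinuousOn f (Icc τ₁ (1 / 2)) := by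
    have h1 : ∀ τ ∈ Icc τ₁ (1 / 2 : ℝ), 1 - τ ≠ 0 := fun τ hτ => by
      have := hτ.2
      have : 0 < 1 - τ := by linarith
      exact this.ne'
    have h2 : ∀ τ ∈ Icc τ₁ (1 / 2 : ℝ), 1 + τ / β ≠ 0 := fun τ hτ => by
      have : 0 < τ := hmem.1.trans_le hτ.1
      positivity
    exact ((ContinuousOn.inv₀ (by fun_prop) h1).pow m).add
      ((ContinuousOn.inv₀ (by fun_prop) h2).pow m)
  obtain ⟨τ, hτ, hτeq⟩ := intermediate_value_Icc hmem.2.le hcont ⟨hlt.le, hge⟩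
  exact ⟨τ, hmem.1.trans_le hτ.1, by linarith [hτ.2], hτeq⟩

/-- Balance means `P^m - 1 = 1 - Q^m`, and `(1+β)/τ = 1/(P-1) + 1/(1-Q)`. The left side becomes
`(2/m) ∑_{i<m} (P^i + Q^i)` by geometric sums, and each summand is at most `2`. -/
lemma balanced_bound {β τ : ℝ} (hβ : 0 < β) (hτ : 0 < τ) (hτ1 : τ < 1) {m : ℕ} (hm : m ≠ 0)
    (h : ((1 - τ)⁻¹) ^ m + ((1 + τ / β)⁻¹) ^ m = 2) :
    (1 + β) * ((((1 - τ)⁻¹) ^ m - ((1 + τ / β)⁻¹) ^ m) / (m * τ)) ≤ 4 := by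
  have h1τ : 0 < 1 - τ := by linarith
  set P := (1 - τ)⁻¹ with hP
  set Q := (1 + τ / β)⁻¹ with hQ
  have hP0 : 0 < P := by positivity
  have hQ0 : 0 < Q := by positivity
  have hP1 : 0 < P - 1 := by
    have : P - 1 = τ * P := by rw [hP]; field_simp; ring
    rw [this]; positivity
  have hQ1 : 0 < 1 - Q := by
    have : 1 - Q = τ / β * Q := by rw [hQ]; field_simp; ring
    rw [this]; positivity
  have hmain : (P ^ m - 1) / (P - 1) + (1 - Q ^ m) / (1 - Q) ≤ 2 * m := by
    rw [← geom_sum_eq (sub_pos.mp hP1).ne' m,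
      ← neg_sub (Q ^ m), ← neg_sub Q, neg_div_neg_eq, ← geom_sum_eq (sub_pos.mp hQ1).ne m,
      ← Finset.sum_add_distrib]
    refine (Finset.sum_le_card_nsmul _ _ 2 fun i hi =>
      pow_add_pow_le_two hP0.le hQ0.le (Finset.mem_range.mp hi).le hm h).trans (le_of_eq ?_)
    simp [mul_comm]
  have hδ : 1 - Q ^ m = P ^ m - 1 := by linarith
  have hδ2 : P ^ m - Q ^ m = 2 * (P ^ m - 1) := by linarith
  have hratio : (1 + β) / τ = 1 / (P - 1) + 1 / (1 - Q) := by
    have e1 : P - 1 = τ / (1 - τ) := by rw [hP]; field_simp; ring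
    have e2 : 1 - Q = τ / (β + τ) := by rw [hQ]; field_simp; ring
    rw [e1, e2]; field_simp; ring
  rw [hδ] at hmain
  have hm' : (0 : ℝ) < m := by positivity
  calc (1 + β) * ((P ^ m - Q ^ m) / (m * τ))
      = 2 * ((P ^ m - 1) * ((1 + β) / τ)) / m := by rw [hδ2]; field_simp
    _ = 2 * ((P ^ m - 1) / (P - 1) + (P ^ m - 1) / (1 - Q)) / m := by rw [hratio]; ring
    _ ≤ 2 * (2 * m) / m := by gcongr
    _ = 4 := by field_simp; norm_num

/-- The exponent `d + 2` is the ambient dimension `d + 1` plus one, and integration lowers it to `m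
= d + 1`. The bound `κ + lp` is the tangent at `p = 0` of the concave weighted length. -/
lemma exists_fiber_bound {β : ℝ} (hβ : 0 < β) (hβ1 : β ≤ 1) (d : ℕ) :
    ∃ τ κ l : ℝ, 0 ≤ τ ∧ τ < 1 ∧ 0 ≤ κ ∧ (1 + β) * κ ≤ 4 ∧ ∀ p ≤ 1, 0 ≤ κ + l * p ∧
      ∫⁻ s in Icc (((1 + β) * p - 1) / β) 1, ENNReal.ofReal (((1 - τ * s)⁻¹) ^ (d + 2)) ≤
        ENNReal.ofReal (κ + l * p) := by
  rcases hβ1.eq_or_lt with rfl | hβ1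
  -- At `β = 1` no shift is needed: the fiber `[2p - 1, 1]` has length exactly `2 - 2p`.
  · refine ⟨0, 2, -2, le_rfl, one_pos, by norm_num, by norm_num, fun p hp => ⟨by linarith, ?_⟩⟩
    simp only [zero_mul, sub_zero, inv_one, one_pow, ENNReal.ofReal_one, setLIntegral_one,
      Real.volume_Icc]
    exact ENNReal.ofReal_le_ofReal (by linarith)
  obtain ⟨τ, hτ, hτ1, hbal⟩ := exists_balanced hβ hβ1 (Nat.succ_ne_zero d)
  have hbound := balanced_bound hβ hτ hτ1 (Nat.succ_ne_zero d) hbal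
  set Q := (1 + τ / β)⁻¹ with hQ
  set m := d + 1 with hm
  have hQ0 : 0 < Q := by positivity
  have hm0 : (0 : ℝ) < m := by positivity
  have h1τ : 0 < 1 - τ := by linarith
  have hval : ∀ p ≤ 1, ∃ I : ℝ, 0 ≤ I ∧
      ∫⁻ s in Icc (((1 + β) * p - 1) / β) 1, ENNReal.ofReal (((1 - τ * s)⁻¹) ^ (d + 2)) =
        ENNReal.ofReal I ∧
      I ≤ (((1 - τ)⁻¹) ^ m - Q ^ m) / (m * τ) + -(Q ^ m * (Q * (1 + β) / β)) * p := by
    intro p hp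
    set lo := ((1 + β) * p - 1) / β with hlo
    have hlo1 : lo ≤ 1 := by rw [hlo, div_le_one hβ]; nlinarith
    have hpos : ∀ s ≤ 1, 0 < 1 - τ * s := fun s hs => by nlinarith
    set G : ℝ → ℝ := fun s => ((1 - τ * s)⁻¹) ^ m / (m * τ) with hG
    refine ⟨G 1 - G lo, ?_, ?_, ?_⟩
    · rw [sub_nonneg]
      simp only [hG]
      have h1 := hpos 1 le_rfl
      have h2 := hpos lo hlo1
      have h3 : 1 - τ * 1 ≤ 1 - τ * lo := by nlinarith
      gcongr
    · refine setLIntegral_Icc_ofReal_of_hasDerivAt hlo1 (fun s hs => ?_) ?_ fun s hs => ?_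
      · have hs' := (hpos s hs.2).ne'
        have := (((((hasDerivAt_id s).const_mul τ).const_sub 1).inv hs').pow m).div_const
          ((m : ℝ) * τ)
        refine this.congr_deriv ?_
        simp only [id, hm, Nat.add_sub_cancel]
        have : ((d : ℝ) + 1) ≠ 0 := by positivity
        push_cast
        simp only [Pi.inv_apply]
        have hpow : ((1 - τ * s)⁻¹) ^ (d + 2) = ((1 - τ * s)⁻¹) ^ d / (1 - τ * s) ^ 2 := by
          rw [pow_add, inv_pow _ 2, div_eq_mul_inv]
        rw [hpow]
        field_simp
      · refine ContinuousOn.pow (ContinuousOn.inv₀ (by fun_prop) fun s hs => ?_) _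
        exact (hpos s hs.2).ne'
      · have := hpos s hs.2
        positivity
    -- This `k` makes `Q(1 - τ lo) = 1 - kp`, so Bernoulli's inequality in `kp` is the tangent line
    -- bound at `p = 0`.
    · set k := Q * τ * (1 + β) / β with hk
      have hlo2 : 1 - k * p = Q * (1 - τ * lo) := by
        rw [hk, hlo, hQ]; field_simp; ring
      have hkp : 0 < 1 - k * p := by
        rw [hlo2]; exact mul_pos hQ0 (hpos lo hlo1)
      have hB := one_add_le_inv_one_sub_pow hkp le_rfl m
      have hsq : 0 ≤ (m : ℝ) * ((k * p) ^ 2 / (1 - k * p)) := by positivity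
      have hlo3 : (1 - τ * lo)⁻¹ = Q * (1 - k * p)⁻¹ := by
        rw [hlo2]; field_simp
      have hlow : Q ^ m * (1 + m * (k * p)) ≤ ((1 - τ * lo)⁻¹) ^ m := by
        rw [hlo3, mul_pow]
        gcongr
        linarith
      have hmτ : 0 < (m : ℝ) * τ := by positivity
      have hfin : G 1 - G lo ≤ (((1 - τ)⁻¹) ^ m - Q ^ m * (1 + m * (k * p))) / (m * τ) := by
        simp only [hG, mul_one]
        rw [← sub_div]
        gcongr
      refine hfin.trans (le_of_eq ?_)
      rw [hk]
      field_simp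
      ring
  refine ⟨τ, (((1 - τ)⁻¹) ^ m - Q ^ m) / (m * τ), -(Q ^ m * (Q * (1 + β) / β)),
    hτ.le, hτ1, ?_, hbound, fun p hp => ?_⟩
  · obtain ⟨I, hI0, _, hI⟩ := hval 0 zero_le_one
    rw [mul_zero, add_zero] at hI
    exact hI0.trans hI
  · obtain ⟨I, hI0, hI1, hI⟩ := hval p hp
    exact ⟨hI0.trans hI, hI1 ▸ ENNReal.ofReal_le_ofReal hI⟩

end OneDim

/-! ### Polar bodies of double pyramids and the comparison -/

section PolarPyramid

variable {d : ℕ} {L : Set (EuclideanSpace ℝ (Fin d))} {x y : EuclideanSpace ℝ (Fin (d + 1))}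
  {c : EuclideanSpace ℝ (Fin d)} {β : ℝ}

/-- Only the constraints from `L`, `x` and `y` matter. Since `y = (1+β)c - βx`, the one from `y` is
a lower bound on `⟨u, x⟩`. -/
lemma CrossesAt.mem_polarAt_iff (h : CrossesAt L x y c β) (u : EuclideanSpace ℝ (Fin (d + 1))) :
    u ∈ polarAt (doublePyramid L x y) 0 ↔ initPoint u ∈ polarAt L 0 ∧
      inner ℝ u x ∈ Icc (((1 + β) * inner ℝ (initPoint u) c - 1) / β) 1 := by
  have hy : inner ℝ u y = (1 + β) * inner ℝ (initPoint u) c - β * inner ℝ u x := by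
    rw [h.eq, inner_sub_right, inner_smul_right, inner_smul_right, inner_embedHyperplane]
  have hβ := h.pos
  have hy' : inner ℝ u y ≤ 1 ↔
      ((1 + β) * inner ℝ (initPoint u) c - 1) / β ≤ inner ℝ u x := by
    rw [hy, div_le_iff₀ hβ]
    constructor <;> intro _ <;> linarith
  rw [mem_Icc, ← hy', mem_polarAt_zero, mem_polarAt_zero]
  constructor
  · intro hu
    refine ⟨fun l hl => ?_, hu y ?_, hu x ?_⟩
    · rw [← inner_embedHyperplane]
      exact hu _ (subset_doublePyramid _ _ _ (Or.inl ⟨l, hl, rfl⟩))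
    · exact subset_doublePyramid _ _ _ (Or.inr (Or.inr rfl))
    · exact subset_doublePyramid _ _ _ (Or.inr (Or.inl rfl))
  · rintro ⟨hl, hyu, hxu⟩
    have : doublePyramid L x y ⊆ {w | inner ℝ u w ≤ 1} := by
      refine closedConvexHull_min ?_ ?_ (isClosed_le (by fun_prop) continuous_const)
      · rintro _ (⟨l, hl', rfl⟩ | rfl | rfl)
        · simpa [inner_embedHyperplane] using hl l hl'
        · exact hxu
        · exact hyu
      · exact convex_halfSpace_le (innerSL ℝ u).toLinearMap.isLinear 1
    exact fun w hw => this hw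

/-- Integration over the polar body of a double pyramid, in the coordinates `(u', ⟨u, x⟩)`. -/
lemma CrossesAt.setLIntegral_polarAt (h : CrossesAt L x y c β) {F : ℝ → ℝ≥0∞}
    (hF : Measurable F) :
    ∫⁻ u in polarAt (doublePyramid L x y) 0, F (inner ℝ u x) =
      ENNReal.ofReal |(x (Fin.last d))⁻¹| *
        ∫⁻ v in polarAt L 0, ∫⁻ s in Icc (((1 + β) * inner ℝ v c - 1) / β) 1, F s := by
  set W : Set (EuclideanSpace ℝ (Fin d) × ℝ) :=
    {q | q.1 ∈ polarAt L 0 ∧ q.2 ∈ Icc (((1 + β) * inner ℝ q.1 c - 1) / β) 1} with hW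
  have hWm : MeasurableSet W := by
    refine IsClosed.measurableSet ?_
    refine ((isClosed_polarAt L 0).preimage continuous_fst).inter
      ((isClosed_le (f := fun q : EuclideanSpace ℝ (Fin d) × ℝ =>
        ((1 + β) * inner ℝ q.1 c - 1) / β) (g := fun q => q.2) (by fun_prop) (by fun_prop)).inter
      (isClosed_le (f := fun q : EuclideanSpace ℝ (Fin d) × ℝ => q.2) (by fun_prop)
        continuous_const))
  have hmeas : Measurable fun u : EuclideanSpace ℝ (Fin (d + 1)) =>
      (initPoint u, (inner ℝ u x : ℝ)) :=
    (continuous_initPoint.prodMk (by fun_prop)).measurable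
  have hpre : polarAt (doublePyramid L x y) 0 =
      (fun u => (initPoint u, (inner ℝ u x : ℝ))) ⁻¹' W := by
    ext u; exact h.mem_polarAt_iff u
  have hF2 : Measurable fun q : EuclideanSpace ℝ (Fin d) × ℝ => F q.2 := hF.comp measurable_snd
  have h1 := setLIntegral_map (μ := volume) hWm hF2 hmeas
  rw [hpre, ← h1, map_initPoint_inner h.last_ne, Measure.restrict_smul, lintegral_smul_measure,
    smul_eq_mul, ← lintegral_indicator hWm,
    lintegral_prod _ (hF2.indicator hWm).aemeasurable,
    ← lintegral_indicator (isClosed_polarAt L 0).measurableSet]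
  congr 1
  refine lintegral_congr fun v => ?_
  by_cases hv : v ∈ polarAt L 0
  · rw [indicator_of_mem hv, ← lintegral_indicator measurableSet_Icc]
    refine lintegral_congr fun s => ?_
    by_cases hs : s ∈ Icc (((1 + β) * inner ℝ v c - 1) / β) 1
    · rw [indicator_of_mem hs, indicator_of_mem (show (v, s) ∈ W from ⟨hv, hs⟩)]
    · rw [indicator_of_notMem hs, indicator_of_notMem fun h' : (v, s) ∈ W => hs h'.2]
  · rw [indicator_of_notMem hv, ← lintegral_zero]
    refine lintegral_congr fun s => ?_
    simp [indicator, hW, hv]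

/-- The center is `τx`, interior because `0` is interior and `τ < 1`. The slope `l` disappears
because `⟨v, c⟩` has integral `0` over `L^0`. -/
lemma CrossesAt.exists_volume_polarAt_le (h : CrossesAt L x y c β) (hβ1 : β ≤ 1)
    (hL : IsConvexBody L) (h0 : 0 ∈ interior L)
    (hc : ∫ v in polarAt L 0, inner ℝ v c = 0) :
    ∃ z ∈ interior (doublePyramid L x y), ∃ κ : ℝ, 0 ≤ κ ∧ (1 + β) * κ ≤ 4 ∧
      volume (polarAt (doublePyramid L x y) z) ≤
        ENNReal.ofReal (|(x (Fin.last d))⁻¹| * κ) * volume (polarAt L 0) := by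
  obtain ⟨τ, κ, l, hτ, hτ1, hκ, hκ4, hfib⟩ := exists_fiber_bound h.pos hβ1 d
  have hint := h.zero_mem_interior hL h0
  have hx : x ∈ doublePyramid L x y := subset_doublePyramid _ _ _ (Or.inr (Or.inl rfl))
  have hz : τ • x ∈ interior (doublePyramid L x y) := by
    have := (convex_doublePyramid L x y).combo_interior_self_mem_interior hint hx
      (show 0 < 1 - τ by linarith) hτ (by ring)
    simpa using this
  refine ⟨τ • x, hz, κ, hκ, hκ4, ?_⟩
  have hF : Measurable fun s : ℝ => ENNReal.ofReal (((1 - τ * s)⁻¹) ^ (d + 2)) := by fun_prop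
  have hcpt := isCompact_polarAt_zero h0
  have hi1 : IntegrableOn (fun v : EuclideanSpace ℝ (Fin d) => inner ℝ v c) (polarAt L 0) :=
    ContinuousOn.integrableOn_compact hcpt (by fun_prop)
  have hi0 : IntegrableOn (fun _ : EuclideanSpace ℝ (Fin d) => κ) (polarAt L 0) :=
    ContinuousOn.integrableOn_compact hcpt (by fun_prop)
  have hp : ∀ v ∈ polarAt L 0, inner ℝ v c ≤ 1 := fun v hv => mem_polarAt_zero.mp hv c h.mem
  have hbase : ∫⁻ v in polarAt L 0, ENNReal.ofReal (κ + l * inner ℝ v c) =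
      ENNReal.ofReal κ * volume (polarAt L 0) := by
    have hi : IntegrableOn (fun v : EuclideanSpace ℝ (Fin d) => κ + l * inner ℝ v c)
        (polarAt L 0) := hi0.add (hi1.const_mul l)
    rw [← ofReal_integral_eq_lintegral_ofReal hi
      ((ae_restrict_iff' hcpt.measurableSet).mpr
        (Filter.Eventually.of_forall fun v hv => (hfib _ (hp v hv)).1)),
      integral_add hi0 (hi1.const_mul l), integral_const_mul, hc, setIntegral_const, mul_zero,
      add_zero, smul_eq_mul, mul_comm, ENNReal.ofReal_mul hκ,
      ofReal_measureReal (volume_polarAt_zero_lt_top h0).ne]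
  rw [volume_polarAt hint hz, ENNReal.ofReal_mul (abs_nonneg _), mul_assoc, ← hbase]
  simp_rw [inner_smul_right]
  rw [h.setLIntegral_polarAt hF]
  refine mul_le_mul_right ?_ _
  exact setLIntegral_mono' hcpt.measurableSet fun v hv => (hfib _ (hp v hv)).2

lemma CrossesAt.volumeProduct_le (h : CrossesAt L x y c β) (hL : IsConvexBody L)
    (h0 : 0 ∈ interior L) (hc : ∫ v in polarAt L 0, inner ℝ v c = 0) :
    volumeProduct (doublePyramid L x y) ≤
      ENNReal.ofReal (4 / (d + 1)) * (volume L * volume (polarAt L 0)) := by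
  -- Exchanging the apexes replaces `β` by `β⁻¹`.
  wlog hβ1 : β ≤ 1 generalizing x y β
  · rw [doublePyramid_comm]
    exact this h.symm (inv_le_one_of_one_le₀ (not_le.mp hβ1).le)
  obtain ⟨z, hz, κ, hκ, hκ4, hvol⟩ := h.exists_volume_polarAt_le hβ1 hL h0 hc
  have hβ := h.pos
  have hx := h.last_ne
  calc volumeProduct (doublePyramid L x y)
      ≤ volume (doublePyramid L x y) * volume (polarAt (doublePyramid L x y) z) :=
        iInf₂_le z hz
    _ ≤ (ENNReal.ofReal (|x (Fin.last d)| * ((1 + β) / (d + 1))) * volume L) *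
        (ENNReal.ofReal (|(x (Fin.last d))⁻¹| * κ) * volume (polarAt L 0)) := by
        rw [h.volume_doublePyramid hL]; gcongr
    _ = ENNReal.ofReal ((1 + β) * κ / (d + 1)) * (volume L * volume (polarAt L 0)) := by
        rw [mul_mul_mul_comm, ← ENNReal.ofReal_mul (by positivity)]
        congr 2
        rw [abs_inv]
        have := abs_pos.mpr hx
        field_simp
    _ ≤ _ := by gcongr

/-- With `c = 0` and `β = 1` every fiber is `[-1, 1]`. Splitting `z` into a multiple of `x` and a
vector of the hyperplane, both parts integrate to `0` over the product. -/
lemma setIntegral_polarAt_symmetric_inner (h : CrossesAt L x y 0 1) (h0 : 0 ∈ interior L)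
    (hc : ∀ w, ∫ v in polarAt L 0, inner ℝ v w = 0) (z : EuclideanSpace ℝ (Fin (d + 1))) :
    ∫ u in polarAt (doublePyramid L x y) 0, inner ℝ u z = 0 := by
  set W : Set (EuclideanSpace ℝ (Fin d) × ℝ) := polarAt L 0 ×ˢ Icc (-1) 1 with hW
  set ψ : EuclideanSpace ℝ (Fin (d + 1)) → EuclideanSpace ℝ (Fin d) × ℝ :=
    fun u => (initPoint u, inner ℝ u x) with hψ
  have hmeas : Measurable ψ := (continuous_initPoint.prodMk (by fun_prop)).measurable
  have hcpt : IsCompact W := (isCompact_polarAt_zero h0).prod isCompact_Icc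
  have hpre : polarAt (doublePyramid L x y) 0 = ψ ⁻¹' W := by
    ext u
    rw [h.mem_polarAt_iff u]
    simp [hW, hψ]
  set r := z (Fin.last d) / x (Fin.last d) with hr
  set w := initPoint z - r • initPoint x with hw
  have hz : z = r • x + embedHyperplane w := by
    have hx : x = snocPoint (initPoint x) (x (Fin.last d)) := (snocPoint_initPoint x).symm
    rw [← snocPoint_initPoint z, congrArg (r • ·) hx, smul_snocPoint, embedHyperplane_eq,
      snocPoint_add, snocPoint_inj]
    refine ⟨by rw [hw]; abel, ?_⟩
    rw [hr, div_mul_cancel₀ _ h.last_ne, add_zero]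
  have hg : Continuous fun q : EuclideanSpace ℝ (Fin d) × ℝ => r * q.2 + inner ℝ q.1 w := by
    fun_prop
  have hzu : ∀ u, inner ℝ u z = (fun q : EuclideanSpace ℝ (Fin d) × ℝ =>
      r * q.2 + inner ℝ q.1 w) (ψ u) := by
    intro u
    rw [hz, inner_add_right, inner_smul_right, inner_embedHyperplane]
  simp_rw [hzu]
  rw [hpre, ← setIntegral_map hcpt.measurableSet hg.aestronglyMeasurable hmeas.aemeasurable,
    hψ, map_initPoint_inner h.last_ne, Measure.restrict_smul, integral_smul_measure]
  have hi1 : IntegrableOn (fun q : EuclideanSpace ℝ (Fin d) × ℝ => r * q.2) W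
      (volume.prod volume) :=
    ContinuousOn.integrableOn_compact hcpt (by fun_prop)
  have hi2 : IntegrableOn (fun q : EuclideanSpace ℝ (Fin d) × ℝ => inner ℝ q.1 w) W
      (volume.prod volume) :=
    ContinuousOn.integrableOn_compact hcpt (by fun_prop)
  have hI : ∫ q in W, (r * q.2 + inner ℝ q.1 w) ∂(volume.prod volume) = 0 := by
    rw [integral_add hi1 hi2]
    have e1 := setIntegral_prod_mul (μ := (volume : Measure (EuclideanSpace ℝ (Fin d))))
      (ν := (volume : Measure ℝ)) (fun _ => r) (fun s : ℝ => s) (polarAt L 0) (Icc (-1) 1)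
    have e2 := setIntegral_prod_mul (μ := (volume : Measure (EuclideanSpace ℝ (Fin d))))
      (ν := (volume : Measure ℝ)) (fun v => inner ℝ v w) (fun _ : ℝ => (1 : ℝ)) (polarAt L 0)
      (Icc (-1) 1)
    simp only [mul_one] at e2
    rw [e1, e2, hc w, zero_mul, add_zero, integral_Icc_eq_integral_Ioc,
      ← intervalIntegral.integral_of_le (by norm_num), integral_id]
    norm_num
  rw [hI, smul_zero]

/-- The centroid condition makes `0` the optimal center, where the fibers have length `2`; with `1 +
β = 2` this produces the constant `4`. -/
lemma le_volumeProduct_of_symmetric (h : CrossesAt L x y 0 1) (hL : IsConvexBody L)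
    (h0 : 0 ∈ interior L) (hc : ∀ w, ∫ v in polarAt L 0, inner ℝ v w = 0) :
    ENNReal.ofReal (4 / (d + 1)) * (volume L * volume (polarAt L 0)) ≤
      volumeProduct (doublePyramid L x y) := by
  refine le_iInf₂ fun z hz => ?_
  have hint := h.zero_mem_interior hL h0
  have hmin := volume_polarAt_zero_le hint hz (setIntegral_polarAt_symmetric_inner h h0 hc z)
  have hpol : volume (polarAt (doublePyramid L x y) 0) =
      ENNReal.ofReal (|(x (Fin.last d))⁻¹| * 2) * volume (polarAt L 0) := by
    have := h.setLIntegral_polarAt (F := fun _ => 1) measurable_const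
    simp only [setLIntegral_one, Real.volume_Icc, inner_zero_right] at this
    rw [this, setLIntegral_const, ← mul_assoc, ← ENNReal.ofReal_mul (abs_nonneg _)]
    norm_num
  refine le_trans (le_of_eq ?_) (mul_le_mul_right hmin _)
  rw [hpol, h.volume_doublePyramid hL, mul_mul_mul_comm, ← ENNReal.ofReal_mul (by positivity)]
  congr 2
  rw [abs_inv]
  have := abs_pos.mpr h.last_ne
  field_simp
  norm_num

end PolarPyramid

theorem corollary5p2 (d : ℕ) (L : Set (EuclideanSpace ℝ (Fin d))) (hL : IsConvexBody L)
    (hFix : ∃ p, fixSet L = {p}) :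
    (∃! s, IsSantaloPoint L s) ∧
      ∀ s, IsSantaloPoint L s →
        ∀ x₀ y₀ : EuclideanSpace ℝ (Fin (d + 1)),
          x₀ (Fin.last d) ≠ 0 → midpoint ℝ x₀ y₀ = embedHyperplane s →
            SeparatesApexes L x₀ y₀ ∧
              ∀ x y : EuclideanSpace ℝ (Fin (d + 1)), SeparatesApexes L x y →
                volumeProduct (doublePyramid L x y) ≤ volumeProduct (doublePyramid L x₀ y₀) := by
  have h0 := zero_mem_interior_of_fixSet hL hFix
  have hc := setIntegral_polarAt_inner_of_fixSet hL hFix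
  refine ⟨⟨0, (isSantaloPoint_iff_eq_zero hL hFix 0).mpr rfl,
    fun s hs => (isSantaloPoint_iff_eq_zero hL hFix s).mp hs⟩, ?_⟩
  intro s hs x₀ y₀ hx₀ hmid
  obtain rfl := (isSantaloPoint_iff_eq_zero hL hFix s).mp hs
  have he : embedHyperplane (0 : EuclideanSpace ℝ (Fin d)) = 0 := by
    have := smul_snocPoint 0 (0 : EuclideanSpace ℝ (Fin d)) 0
    rw [embedHyperplane_eq]
    simpa using this.symm
  have hy₀ : y₀ = -x₀ := by
    rw [he, midpoint_eq_smul_add, smul_eq_zero] at hmid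
    rcases hmid with h | h
    · norm_num at h
    · exact (neg_eq_of_add_eq_zero_right h).symm
  have hcross : CrossesAt L x₀ y₀ 0 1 :=
    ⟨hx₀, interior_subset h0, one_pos, by rw [he, hy₀]; simp⟩
  refine ⟨⟨?_, embedHyperplane 0, hmid ▸ midpoint_mem_segment x₀ y₀,
    mem_image_of_mem _ (interior_subset h0)⟩, fun x y hxy => ?_⟩
  · rw [hy₀]
    simp only [PiLp.neg_apply, mul_neg, Left.neg_neg_iff]
    exact mul_self_pos.mpr hx₀
  · obtain ⟨c, β, h⟩ := hxy.exists_crossesAt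
    exact (h.volumeProduct_le hL h0 (hc c)).trans
      (le_volumeProduct_of_symmetric hcross hL h0 hc)
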